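/- Let $\sigma\ge 0$ and let $f\in L^1_{\mathrm{loc}}(\mathbb R)$ satisfy $f(t+1)=f(t)$ and $f(t)-\sigma>0$ for almost every $t$. Let $$\Phi(t)=\inf\Big\{s>t:\ e^{\sigma t}\le\int_t^{s}[f(u)-\sigma]e^{\sigma u}\,du\Big\},\qquad t\in\mathbb R,$$ be the firing map of the leaky integrate-and-fire model $\dot x=-\sigma x+f(t)$ (threshold $1$, reset $0$). It is a lift of an orientation preserving homeomorphism $\varphi$ of the circle $\mathbb R/\mathbb Z$; assume that its rotation number $\varrho(\Phi)=\lim_{n\to\infty}\Phi^n(t)/n$ is irrational. Put $\mathrm{ISI}_i(t)=\Phi^{i+1}(t)-\Phi^{i}(t)$ for $i\ge 0$, and let $\Psi(t)=\Phi(t)-t$, viewed as a function on $\mathbb R/\mathbb Z$. Then $\varphi$ has a unique invariant Borel probability measure $\mu$ on $\mathbb R/\mathbb Z$, and with $\mu_{\mathrm{ISI}}(A)=\mu(\Psi^{-1}(A))$ for Borel $A\subset\mathbb R$ the following hold. 1. If $A\subset\mathbb R$ is a Borel set such that $\mu(\partial(\Psi^{-1}(A)))=0$, in particular if $A$ is a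 continuity set of $\mu_{\mathrm{ISI}}$, that is, $\mu_{\mathrm{ISI}}(\partial A)=0$, then $$\lim_{n\to\infty}\frac{\#\{0\le i\le n-1:\ \mathrm{ISI}_i(t)\in A\}}{n}=\mu_{\mathrm{ISI}}(A)$$ uniformly in $t\in\mathbb R$. For an arbitrary Borel set $A\subset\mathbb R$ this limit relation holds for every $t$ whose class mod $1$ lies outside a $\mu$-null set (depending on $A$). 2. For every $t\in\mathbb R$ the average interspike interval $\mathrm{aISI}=\lim_{n\to\infty}\Phi^n(t)/n$ exists and equals $\varrho(\Phi)$, and it is the mean of $\mu_{\mathrm{ISI}}$ (the integrals being absolutely convergent): $$\mathrm{aISI}=\int_{\mathbb R/\mathbb Z}\Psi\,d\mu=\int_{\mathbb R}s\,d\mu_{\mathrm{ISI}}(s).$$ -/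

import Mathlib

open MeasureTheory Filter Topology

noncomputable section

namespace LIF

/-- The firing map of `x' = -σ x + f(t)` with threshold `1` and reset value `0`, for a locally
integrable input `f`:
`Φ(t) = inf {s > t : e^{σ t} ≤ ∫_t^s (f(u) - σ) e^{σ u} du}`. -/
def firingMap (σ : ℝ) (f : ℝ → ℝ) (t : ℝ) : ℝ :=
  sInf {s : ℝ | t < s ∧
    Real.exp (σ * t) ≤ ∫ u in t..s, (f u - σ) * Real.exp (σ * u)}

/-- The rotation number `lim_{n → ∞} Φⁿ(t) / n` of a lift `Φ` of an orientation preserving circle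
homeomorphism; it exists and does not depend on `t`, and it is read off here at `t = 0`. -/
def rotationNumber (Φ : ℝ → ℝ) : ℝ :=
  limUnder atTop (fun n : ℕ => Φ^[n] 0 / n)

/-- The `i`-th interspike interval `Φ^{i+1}(t) - Φ^i(t)` of the run that starts at time `t`,
`i = 0, 1, 2, …`. -/
def ISI (Φ : ℝ → ℝ) (i : ℕ) (t : ℝ) : ℝ := Φ^[i + 1] t - Φ^[i] t

open Classical in
/-- `#{0 ≤ i ≤ n - 1 : ISI_i(t) ∈ A} / n`. -/
def isiFrequency (Φ : ℝ → ℝ) (A : Set ℝ) (n : ℕ) (t : ℝ) : ℝ :=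
  (((Finset.range n).filter (fun i => ISI Φ i t ∈ A)).card : ℝ) / n

/-- The representative in `[0, 1)` of a point of the circle `ℝ / ℤ`. -/
def rep (θ : UnitAddCircle) : ℝ := (AddCircle.equivIco (1 : ℝ) 0 θ : ℝ)

/-- The firing phase map `φ = Φ mod 1` on the circle `ℝ / ℤ`. When `Φ(t + 1) = Φ(t) + 1` for
all `t`, the choice of the representative does not matter. -/
def phaseMap (Φ : ℝ → ℝ) (θ : UnitAddCircle) : UnitAddCircle :=
  ((Φ (rep θ) : ℝ) : UnitAddCircle)

/-- The displacement function `Ψ(t) = Φ(t) - t`, as a function on the circle `ℝ / ℤ`. -/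
def displacement (Φ : ℝ → ℝ) (θ : UnitAddCircle) : ℝ := Φ (rep θ) - rep θ

/-- `μ` is a Borel probability measure on the circle that is invariant under the phase map. -/
def IsInvariantProbability (Φ : ℝ → ℝ) (μ : Measure UnitAddCircle) : Prop :=
  IsProbabilityMeasure μ ∧ MeasurePreserving (phaseMap Φ) μ μ

/-- The distribution of interspike intervals with respect to `μ`:
`μ_ISI(A) = μ(Ψ⁻¹(A))` for Borel sets `A ⊆ ℝ`. -/
def isiDistribution (Φ : ℝ → ℝ) (μ : Measure UnitAddCircle) : Measure ℝ :=
  μ.map (displacement Φ)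

end LIF

end

/-! Let `W` be the primitive of `(f - σ) e^{σu}`; it is continuous and strictly increasing. The
firing condition becomes the implicit equation `W(Φ t) = W t + e^{σt}`
(`cumulativeDrive_firingMap`), from which monotonicity, continuity and degree one of `Φ` are read
off.

Since the translation number `r` is irrational, there are monotone degree one maps `F`, `G` with `F
∘ Φ = r + F` and `G(r + y) = Φ(G y)`. Pushing Lebesgue measure through `G` gives an invariant
measure. Conversely `F` pushes every invariant measure to Lebesgue measure, and up to a translation
`G` inverts `F` off countably many fibres, so the invariant measure is unique
(`existsUnique_isInvariantProbability`).

The interspike intervals are `Ψ` sampled along a phase orbit, so their frequencies are Birkhoff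
averages of the indicator of `Ψ⁻¹(A)`. Unique ergodicity makes empirical measures converge weakly,
uniformly in the starting point, which handles sets with null boundary. For arbitrary Borel sets the
indicator is approximated in `L¹` by continuous functions and the error is controlled by the maximal
ergodic theorem. Finally, Birkhoff sums of `Ψ` telescope to `Φⁿ(t) - t`, which identifies the mean
with the rotation number. -/

namespace LIF

/-! ### Maximal ergodic theorem and the weak type inequality. -/

section MaximalInequality

variable {X : Type*}

/-- The maximum of the Birkhoff sums of `f` of lengths `0, …, n`, defined by its recursion. -/
def birkhoffMax (T : X → X) (f : X → ℝ) : ℕ → X → ℝ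
  | 0, _ => 0
  | n + 1, x => max 0 (f x + birkhoffMax T f n (T x))

lemma birkhoffMax_nonneg (T : X → X) (f : X → ℝ) (n : ℕ) (x : X) : 0 ≤ birkhoffMax T f n x := by
  cases n with
  | zero => exact le_rfl
  | succ n => exact le_max_left _ _

lemma birkhoffMax_le_succ (T : X → X) (f : X → ℝ) (n : ℕ) (x : X) :
    birkhoffMax T f n x ≤ birkhoffMax T f (n + 1) x := by
  induction n generalizing x with
  | zero => exact birkhoffMax_nonneg T f 1 x
  | succ n ih =>
    change max 0 (f x + birkhoffMax T f n (T x)) ≤ max 0 (f x + birkhoffMax T f (n + 1) (T x))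
    have := ih (T x)
    gcongr

lemma birkhoffSum_le_birkhoffMax (T : X → X) (f : X → ℝ) (n : ℕ) (x : X) :
    birkhoffSum T f n x ≤ birkhoffMax T f n x := by
  induction n generalizing x with
  | zero => simp [birkhoffMax]
  | succ n ih =>
    rw [birkhoffSum_succ']
    exact (add_le_add_right (ih (T x)) _).trans (le_max_right _ _)

/-- Where the maximum is positive it is attained by a nonempty sum, whose first term splits off.
This pointwise bound drives the maximal ergodic theorem. -/
lemma birkhoffMax_le_of_pos {T : X → X} {f : X → ℝ} {n : ℕ} {x : X}
    (h : 0 < birkhoffMax T f n x) : birkhoffMax T f n x ≤ f x + birkhoffMax T f n (T x) := by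
  cases n with
  | zero => exact absurd h (lt_irrefl _)
  | succ n =>
    have h' : 0 < max 0 (f x + birkhoffMax T f n (T x)) := h
    have h2 : 0 < f x + birkhoffMax T f n (T x) := by simpa using h'
    change max 0 (f x + birkhoffMax T f n (T x)) ≤ _
    rw [max_eq_right h2.le]
    have := birkhoffMax_le_succ T f n (T x)
    gcongr

variable [MeasurableSpace X]

lemma measurable_birkhoffMax {T : X → X} {f : X → ℝ} (hT : Measurable T) (hf : Measurable f)
    (n : ℕ) : Measurable (birkhoffMax T f n) := by
  induction n with
  | zero => exact measurable_const
  | succ n ih => exact measurable_const.max (hf.add (ih.comp hT))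

lemma integrable_birkhoffMax {μ : Measure X} {T : X → X} {f : X → ℝ}
    (hT : MeasurePreserving T μ μ) (hf : Integrable f μ) (n : ℕ) :
    Integrable (birkhoffMax T f n) μ := by
  induction n with
  | zero => exact integrable_zero _ _ _
  | succ n ih => exact (integrable_zero _ _ _).sup (hf.add (hT.integrable_comp_of_integrable ih))

/-- The maximal ergodic theorem. -/
theorem setIntegral_birkhoffMax_pos_nonneg {μ : Measure X} {T : X → X} {f : X → ℝ}
    (hT : MeasurePreserving T μ μ) (hfm : Measurable f) (hf : Integrable f μ) (n : ℕ) :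
    0 ≤ ∫ x in {x | 0 < birkhoffMax T f n x}, f x ∂μ := by
  set M := birkhoffMax T f n with hM
  have hMm : Measurable M := measurable_birkhoffMax hT.measurable hfm n
  have hMi : Integrable M μ := integrable_birkhoffMax hT hf n
  have hMT : Integrable (fun x => M (T x)) μ := hT.integrable_comp_of_integrable hMi
  have hs : MeasurableSet {x | 0 < M x} := measurableSet_lt measurable_const hMm
  have h1 : ∫ x in {x | 0 < M x}, M x - M (T x) ∂μ ≤ ∫ x in {x | 0 < M x}, f x ∂μ := by
    refine setIntegral_mono_on (hMi.sub hMT).integrableOn hf.integrableOn hs fun x hx => ?_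
    have := birkhoffMax_le_of_pos (T := T) (f := f) (n := n) (x := x) hx
    change M x ≤ f x + M (T x) at this
    linarith
  -- Off the set, `M = 0` while `M ∘ T ≥ 0`, so only nonpositive contributions are dropped. The full
  -- integral vanishes by invariance.
  have h2 : ∫ x, M x - M (T x) ∂μ ≤ ∫ x in {x | 0 < M x}, M x - M (T x) ∂μ := by
    rw [← integral_indicator hs]
    refine integral_mono (hMi.sub hMT) ((hMi.sub hMT).indicator hs) fun x => ?_
    by_cases hx : 0 < M x
    · rw [Set.indicator_of_mem (show x ∈ {x | 0 < M x} from hx)]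
    · rw [Set.indicator_of_notMem (show x ∉ {x | 0 < M x} from hx)]
      have := birkhoffMax_nonneg T f n (T x)
      change 0 ≤ M (T x) at this
      change M x - M (T x) ≤ 0
      linarith
  have h3 : ∫ x, M (T x) ∂μ = ∫ x, M x ∂μ := by
    have := integral_map (μ := μ) hT.aemeasurable (f := M) (by rw [hT.map_eq]; exact hMi.1)
    rw [← this, hT.map_eq]
  rw [integral_sub hMi hMT, h3, sub_self] at h2
  exact h2.trans h1

/-- The weak type `(1, 1)` inequality for the maximal function of Birkhoff averages. -/
theorem measure_exists_lt_birkhoffSum_le {μ : Measure X} [IsFiniteMeasure μ] {T : X → X}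
    {d : X → ℝ} (hT : MeasurePreserving T μ μ) (hdm : Measurable d) (hd : Integrable d μ)
    (hd0 : ∀ x, 0 ≤ d x) {c : ℝ} (hc : 0 < c) :
    μ {x | ∃ n : ℕ, n * c < birkhoffSum T d n x} ≤ ENNReal.ofReal ((∫ x, d x ∂μ) / c) := by
  -- An average of `d` exceeds `c` exactly when the corresponding Birkhoff sum of `d - c` is
  -- positive.
  set f : X → ℝ := fun x => d x - c with hf
  have hfm : Measurable f := hdm.sub_const c
  have hfi : Integrable f μ := hd.sub (integrable_const c)
  have hsum (n : ℕ) (x : X) : birkhoffSum T f n x = birkhoffSum T d n x - n * c := by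
    simp [birkhoffSum, hf]
  have hsub : {x | ∃ n : ℕ, n * c < birkhoffSum T d n x} ⊆
      ⋃ n, {x | 0 < birkhoffMax T f n x} := by
    rintro x ⟨n, hn⟩
    refine Set.mem_iUnion.2 ⟨n, lt_of_lt_of_le ?_ (birkhoffSum_le_birkhoffMax T f n x)⟩
    rw [hsum]
    linarith
  have hmono : Monotone fun n => {x | 0 < birkhoffMax T f n x} :=
    monotone_nat_of_le_succ fun n x hx => lt_of_lt_of_le hx (birkhoffMax_le_succ T f n x)
  refine (measure_mono hsub).trans ?_
  rw [hmono.measure_iUnion]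
  refine iSup_le fun n => ?_
  have hs : MeasurableSet {x | 0 < birkhoffMax T f n x} :=
    measurableSet_lt measurable_const (measurable_birkhoffMax hT.measurable hfm n)
  have h0 := setIntegral_birkhoffMax_pos_nonneg hT hfm hfi n
  rw [integral_sub hd.integrableOn (integrable_const c).integrableOn, setIntegral_const,
    smul_eq_mul] at h0
  have h1 : ∫ x in {x | 0 < birkhoffMax T f n x}, d x ∂μ ≤ ∫ x, d x ∂μ :=
    setIntegral_le_integral hd (Eventually.of_forall hd0)
  rw [← ofReal_measureReal (measure_ne_top _ _)]
  refine ENNReal.ofReal_le_ofReal ?_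
  rw [le_div_iff₀ hc]
  linarith

end MaximalInequality

/-! ### Equidistribution for uniquely ergodic maps. -/

section UniqueErgodicity

variable {X : Type*} [MeasurableSpace X]

/-- The uniform distribution on the orbit segment `x, T x, …, Tⁿ x`. -/
noncomputable def empiricalMeasure (T : X → X) (n : ℕ) (x : X) : Measure X :=
  ((n + 1 : ℕ) : ENNReal)⁻¹ • ∑ i ∈ Finset.range (n + 1), Measure.dirac (T^[i] x)

instance isProbabilityMeasure_empiricalMeasure (T : X → X) (n : ℕ) (x : X) :
    IsProbabilityMeasure (empiricalMeasure T n x) := by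
  constructor
  simp only [empiricalMeasure, Measure.smul_apply, Measure.finsetSum_apply, measure_univ,
    Finset.sum_const, Finset.card_range, smul_eq_mul, nsmul_eq_mul, mul_one]
  exact ENNReal.inv_mul_cancel (by simp) (ENNReal.natCast_ne_top _)

/-- `empiricalMeasure` as an element of the space of probability measures. -/
noncomputable def empiricalProbability (T : X → X) (n : ℕ) (x : X) : ProbabilityMeasure X :=
  ⟨empiricalMeasure T n x, inferInstance⟩

lemma integral_empiricalMeasure (T : X → X) (n : ℕ) (x : X) {g : X → ℝ} (hg : Measurable g) :
    ∫ y, g y ∂(empiricalMeasure T n x) = birkhoffAverage ℝ T g (n + 1) x := by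
  rw [empiricalMeasure, integral_smul_measure, integral_finsetSum_measure]
  · simp only [integral_dirac' _ _ hg.stronglyMeasurable, birkhoffAverage, birkhoffSum,
      ENNReal.toReal_inv, ENNReal.toReal_natCast]
  · intro i _
    exact (integrable_dirac' hg.stronglyMeasurable (by simp))

lemma real_empiricalMeasure (T : X → X) (n : ℕ) (x : X) {B : Set X} (hB : MeasurableSet B) :
    (empiricalMeasure T n x).real B =
      birkhoffAverage ℝ T (B.indicator fun _ => (1 : ℝ)) (n + 1) x := by
  rw [← integral_empiricalMeasure T n x (measurable_const.indicator hB), integral_indicator hB]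
  simp

variable [TopologicalSpace X] [BorelSpace X]

/-- The empirical measures of a uniquely ergodic map converge weakly, uniformly in the starting
point. -/
theorem tendsto_empiricalMeasure [CompactSpace X] [T2Space X] [HasOuterApproxClosed X]
    {T : X → X} (hT : Continuous T) (μ : ProbabilityMeasure X)
    (huniq : ∀ ν : Measure X, IsProbabilityMeasure ν → MeasurePreserving T ν ν → ν = μ) :
    Tendsto (fun q : ℕ × X => empiricalProbability T q.1 q.2) (atTop ×ˢ ⊤) (𝓝 μ) := by
  -- Probability measures on a compact space form a compact space, so a limit exists along every
  -- ultrafilter; it suffices that this limit is invariant. The factor `⊤` leaves the starting point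
  -- free, which encodes uniformity.
  rw [tendsto_iff_ultrafilter]
  intro U hU
  set e : ℕ × X → ProbabilityMeasure X := fun q => empiricalProbability T q.1 q.2
  obtain ⟨ν, hν⟩ : ∃ ν, Tendsto e U (𝓝 ν) := by
    obtain ⟨ν, -, h⟩ := isCompact_univ.ultrafilter_le_nhds (U.map e) (by simp)
    exact ⟨ν, h⟩
  suffices h : ν = μ from h ▸ hν
  refine Subtype.ext (huniq ν inferInstance ⟨hT.measurable, ?_⟩)
  have hfst : Tendsto (fun q : ℕ × X => q.1) U atTop := tendsto_fst.mono_left hU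
  have : IsProbabilityMeasure ((ν : Measure X).map T) :=
    Measure.isProbabilityMeasure_map hT.aemeasurable
  refine ext_of_forall_integral_eq_of_IsFiniteMeasure fun g => ?_
  rw [integral_map hT.aemeasurable g.continuous.aestronglyMeasurable]
  rw [ProbabilityMeasure.tendsto_iff_forall_integral_tendsto] at hν
  have h1 := hν (g.compContinuous ⟨T, hT⟩)
  have h2 := hν g
  have h3 := h1.sub h2
  refine sub_eq_zero.1 (tendsto_nhds_unique h3 ?_)
  -- The averages of `g` from `x` and from `T x` differ only in the two end terms of the orbit
  -- segment.
  have hb : Tendsto (fun q : ℕ × X => 2 * ‖g‖ / ((q.1 : ℝ) + 1)) U (𝓝 0) :=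
    (tendsto_const_nhds.div_atTop
      (tendsto_atTop_add_const_right _ _ tendsto_natCast_atTop_atTop)).comp hfst
  refine squeeze_zero_norm (fun q => ?_) hb
  have e1 : ∫ y, g (T y) ∂(empiricalMeasure T q.1 q.2) =
      birkhoffAverage ℝ T g (q.1 + 1) (T q.2) := by
    rw [integral_empiricalMeasure T q.1 q.2 (g := fun y => g (T y))
      (g.continuous.measurable.comp hT.measurable)]
    simp only [birkhoffAverage, birkhoffSum, ← Function.iterate_succ_apply,
      Function.iterate_succ_apply']
  change ‖∫ y, g (T y) ∂(empiricalMeasure T q.1 q.2) - ∫ y, g y ∂(empiricalMeasure T q.1 q.2)‖ ≤ _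
  rw [e1, integral_empiricalMeasure T q.1 q.2 g.continuous.measurable, ← dist_eq_norm,
    dist_birkhoffAverage_apply_birkhoffAverage]
  push_cast
  gcongr
  exact g.dist_le_two_norm _ _

/-- For a uniquely ergodic map, visit frequencies to a set with null boundary converge uniformly. -/
theorem tendstoUniformly_birkhoffAverage_indicator [CompactSpace X] [T2Space X]
    [HasOuterApproxClosed X] {T : X → X} (hT : Continuous T) (μ : Measure X)
    [IsProbabilityMeasure μ]
    (huniq : ∀ ν : Measure X, IsProbabilityMeasure ν → MeasurePreserving T ν ν → ν = μ)
    {B : Set X} (hB : MeasurableSet B) (hfr : μ (frontier B) = 0) :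
    TendstoUniformly (fun n x => birkhoffAverage ℝ T (B.indicator fun _ => (1 : ℝ)) n x)
      (fun _ => μ.real B) atTop := by
  let μ' : ProbabilityMeasure X := ⟨μ, inferInstance⟩
  have h := tendsto_empiricalMeasure hT μ' huniq
  have h' := ProbabilityMeasure.tendsto_measure_of_null_frontier_of_tendsto' h (E := B) hfr
  have h2 := (ENNReal.tendsto_toReal (measure_ne_top μ B)).comp h'
  rw [Metric.tendstoUniformly_iff]
  intro ε hε
  -- The empirical measure of index `n` averages over `n + 1` points.
  rw [← map_add_atTop_eq_nat 1, eventually_map]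
  have h3 := (Metric.tendsto_nhds.1 h2) ε hε
  rw [eventually_prod_iff] at h3
  obtain ⟨p, hp, r, hr, hpr⟩ := h3
  filter_upwards [hp] with n hn x
  have := hpr hn (show r x from (eventually_top.1 hr) x)
  rw [dist_comm, ← real_empiricalMeasure T n x hB]
  exact this

/-- For a uniquely ergodic map, visit frequencies to a Borel set converge almost everywhere. -/
theorem ae_tendsto_birkhoffAverage_indicator [CompactSpace X] [T2Space X]
    [HasOuterApproxClosed X] [NormalSpace X] {T : X → X} (hT : Continuous T) (μ : Measure X)
    [IsProbabilityMeasure μ] [μ.WeaklyRegular]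
    (huniq : ∀ ν : Measure X, IsProbabilityMeasure ν → MeasurePreserving T ν ν → ν = μ)
    (hinv : MeasurePreserving T μ μ) {B : Set X} (hB : MeasurableSet B) :
    ∀ᵐ x ∂μ, Tendsto (fun n => birkhoffAverage ℝ T (B.indicator fun _ => (1 : ℝ)) n x) atTop
      (𝓝 (μ.real B)) := by
  set b : X → ℝ := B.indicator fun _ => (1 : ℝ) with hb
  have hbm : Measurable b := measurable_const.indicator hB
  have hbi : Integrable b μ := (integrable_const _).indicator hB
  have hbint : ∫ x, b x ∂μ = μ.real B := by rw [hb, integral_indicator hB]; simp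
  have hcont (g : BoundedContinuousFunction X ℝ) (x : X) :
      Tendsto (fun n => birkhoffAverage ℝ T g n x) atTop (𝓝 (∫ y, g y ∂μ)) := by
    let μ' : ProbabilityMeasure X := ⟨μ, inferInstance⟩
    have h := tendsto_empiricalMeasure hT μ' huniq
    rw [ProbabilityMeasure.tendsto_iff_forall_integral_tendsto] at h
    have h1 := (h g).comp (show Tendsto (fun n : ℕ => (n, x)) atTop (atTop ×ˢ ⊤) from
      tendsto_id.prodMk tendsto_top)
    rw [← tendsto_add_atTop_iff_nat 1]
    refine h1.congr fun n => ?_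
    exact integral_empiricalMeasure T n x g.continuous.measurable
  have hbad (δ : ℝ) (hδ : 0 < δ) :
      ∀ᵐ x ∂μ, ∀ᶠ n in atTop, dist (birkhoffAverage ℝ T b n x) (μ.real B) ≤ δ := by
    rw [ae_iff]
    refine le_antisymm (ENNReal.le_of_forall_pos_le_add fun η hη _ => ?_) zero_le
    rw [zero_add]
    -- The first bound keeps `∫ g` within `δ / 3` of `μ(B)`; the second makes the weak type bound at
    -- level `δ / 3` at most `η`.
    set κ : ℝ := min (δ / 3) (η * (δ / 3))
    have hκ0 : 0 < κ := by positivity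
    obtain ⟨g, hg, hgi⟩ := hbi.exists_boundedContinuous_integral_sub_le hκ0
    set d : X → ℝ := fun x => ‖b x - g x‖ with hd
    have hdm : Measurable d := (hbm.sub g.continuous.measurable).norm
    have hdi : Integrable d μ := (hbi.sub hgi).norm
    have hgint : |∫ x, g x ∂μ - μ.real B| ≤ δ / 3 := by
      rw [abs_sub_comm, ← hbint, ← integral_sub hbi hgi]
      exact (norm_integral_le_integral_norm _).trans (hg.trans (min_le_left _ _))
    have hmax := measure_exists_lt_birkhoffSum_le hinv hdm hdi (fun x => norm_nonneg _)
      (show 0 < δ / 3 by positivity)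
    have hle : ENNReal.ofReal ((∫ x, d x ∂μ) / (δ / 3)) ≤ η := by
      rw [← ENNReal.ofReal_coe_nnreal]
      refine ENNReal.ofReal_le_ofReal ?_
      rw [div_le_iff₀ (by positivity)]
      exact hg.trans (min_le_right _ _)
    -- Outside the exceptional set of the maximal inequality three errors of at most `δ / 3` add up:
    -- averages of `b` against those of `g`, averages of `g` against `∫ g`, and `∫ g` against
    -- `μ(B)`.
    refine (measure_mono ?_).trans (hmax.trans hle)
    intro x hx
    by_contra hcon
    refine hx ?_
    have hcon' : ∀ n : ℕ, birkhoffSum T d n x ≤ n * (δ / 3) := by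
      intro n
      by_contra h
      exact hcon ⟨n, not_le.1 h⟩
    filter_upwards [Metric.tendsto_nhds.1 (hcont g x) (δ / 3) (by positivity),
      eventually_gt_atTop 0] with n hn hn0
    have hn0' : (0 : ℝ) < n := Nat.cast_pos.2 hn0
    have h1 : |birkhoffAverage ℝ T b n x - birkhoffAverage ℝ T g n x| ≤ δ / 3 := by
      have e : birkhoffAverage ℝ T b n x - birkhoffAverage ℝ T g n x =
          (∑ i ∈ Finset.range n, (b (T^[i] x) - g (T^[i] x))) / n := by
        simp only [birkhoffAverage, birkhoffSum, smul_eq_mul, Finset.sum_sub_distrib]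
        ring
      rw [e, abs_div, abs_of_pos hn0', div_le_iff₀ hn0']
      refine (Finset.abs_sum_le_sum_abs _ _).trans ?_
      rw [mul_comm]
      exact hcon' n
    rw [Real.dist_eq] at hn ⊢
    have h2 := abs_sub_le (birkhoffAverage ℝ T b n x) (birkhoffAverage ℝ T g n x) (μ.real B)
    have h3 := abs_sub_le (birkhoffAverage ℝ T g n x) (∫ y, g y ∂μ) (μ.real B)
    linarith
  have hall := ae_all_iff.2 fun k : ℕ => hbad (1 / ((k : ℝ) + 1)) (by positivity)
  filter_upwards [hall] with x hx
  rw [Metric.tendsto_nhds]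
  intro ε hε
  obtain ⟨k, hk⟩ := exists_nat_one_div_lt hε
  filter_upwards [hx k] with n hn
  exact hn.trans_lt hk

end UniqueErgodicity

/-! ### Circle maps and unique ergodicity for irrational rotation number. -/

section Circle

lemma coe_rep (θ : UnitAddCircle) : ((rep θ : ℝ) : UnitAddCircle) = θ :=
  (AddCircle.equivIco (1 : ℝ) 0).symm_apply_apply θ

lemma measurable_rep : Measurable rep :=
  measurable_subtype_coe.comp (AddCircle.measurableEquivIco (1 : ℝ) 0).measurable

lemma exists_rep_coe_eq_add_int (t : ℝ) : ∃ m : ℤ, rep (t : UnitAddCircle) = t + m := by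
  have h : ((rep (t : UnitAddCircle) - t : ℝ) : UnitAddCircle) = 0 := by
    rw [AddCircle.coe_sub, coe_rep, sub_self]
  obtain ⟨m, hm⟩ := (AddCircle.coe_eq_zero_iff (1 : ℝ)).1 h
  refine ⟨m, ?_⟩
  simp only [zsmul_eq_mul, mul_one] at hm
  linarith

lemma coe_add_intCast (t : ℝ) (m : ℤ) : ((t + m : ℝ) : UnitAddCircle) = t := by
  rw [AddCircle.coe_add, (AddCircle.coe_eq_zero_iff (1 : ℝ) (x := m)).2 ⟨m, by simp⟩, add_zero]

lemma phaseMap_coe (F : CircleDeg1Lift) (t : ℝ) :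
    phaseMap F (t : UnitAddCircle) = ((F t : ℝ) : UnitAddCircle) := by
  obtain ⟨m, hm⟩ := exists_rep_coe_eq_add_int t
  rw [phaseMap, hm, F.map_add_int, coe_add_intCast]

lemma displacement_coe (F : CircleDeg1Lift) (t : ℝ) :
    displacement F (t : UnitAddCircle) = F t - t := by
  obtain ⟨m, hm⟩ := exists_rep_coe_eq_add_int t
  rw [displacement, hm, F.map_add_int]
  ring

lemma measurable_phaseMap (F : CircleDeg1Lift) : Measurable (phaseMap F) :=
  AddCircle.measurable_mk'.comp (F.monotone.measurable.comp measurable_rep)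

lemma continuous_phaseMap {F : CircleDeg1Lift} (hF : Continuous F) : Continuous (phaseMap F) := by
  refine (QuotientAddGroup.isQuotientMap_mk _).continuous_iff.2 ?_
  have : phaseMap F ∘ ((↑) : ℝ → UnitAddCircle) = fun t => ((F t : ℝ) : UnitAddCircle) :=
    funext (phaseMap_coe F)
  exact this ▸ (AddCircle.continuous_mk' 1).comp hF

lemma continuous_displacement {F : CircleDeg1Lift} (hF : Continuous F) :
    Continuous (displacement F) := by
  refine (QuotientAddGroup.isQuotientMap_mk _).continuous_iff.2 ?_
  have : displacement F ∘ ((↑) : ℝ → UnitAddCircle) = fun t => F t - t :=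
    funext (displacement_coe F)
  exact this ▸ hF.sub continuous_id

lemma iterate_phaseMap_coe (F : CircleDeg1Lift) (n : ℕ) (t : ℝ) :
    (phaseMap F)^[n] (t : UnitAddCircle) = ((F^[n] t : ℝ) : UnitAddCircle) := by
  induction n generalizing t with
  | zero => rfl
  | succ n ih => rw [Function.iterate_succ_apply, phaseMap_coe, ih, Function.iterate_succ_apply]

lemma displacement_iterate_phaseMap_coe (F : CircleDeg1Lift) (n : ℕ) (t : ℝ) :
    displacement F ((phaseMap F)^[n] (t : UnitAddCircle)) = ISI F n t := by
  rw [iterate_phaseMap_coe, displacement_coe, ISI, Function.iterate_succ_apply']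

/-- The bridge from spike statistics to ergodic averages: `ISI_i(t)` is `Ψ` at the `i`-th phase of
the orbit. -/
lemma isiFrequency_eq_birkhoffAverage (F : CircleDeg1Lift) (A : Set ℝ) (n : ℕ) (t : ℝ) :
    isiFrequency F A n t = birkhoffAverage ℝ (phaseMap F)
      ((displacement F ⁻¹' A).indicator fun _ => (1 : ℝ)) n (t : UnitAddCircle) := by
  classical
  simp only [isiFrequency, birkhoffAverage, birkhoffSum, Set.indicator_apply, Set.mem_preimage,
    displacement_iterate_phaseMap_coe, Finset.sum_boole, smul_eq_mul]
  rw [div_eq_inv_mul]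

lemma volume_singleton_circle (x : UnitAddCircle) : volume ({x} : Set UnitAddCircle) = 0 := by
  rw [← Metric.closedBall_zero, AddCircle.volume_closedBall]
  simp

/-- Lebesgue measure is the only probability measure on the circle that is invariant under an
irrational rotation. -/
theorem eq_volume_of_map_irrational_rotation (m : Measure UnitAddCircle) [IsProbabilityMeasure m]
    {r : ℝ} (hr : Irrational r) (h : m.map (fun x => (r : UnitAddCircle) + x) = m) :
    m = volume := by
  have hdense : DenseRange (fun n : ℤ => n • (r : UnitAddCircle)) :=
    AddCircle.denseRange_zsmul_coe_iff.2 (by simpa using hr)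
  have hinv : m.IsAddLeftInvariant := by
    refine ⟨fun s => ?_⟩
    have : IsProbabilityMeasure (m.map (s + ·)) :=
      Measure.isProbabilityMeasure_map (measurable_const_add s).aemeasurable
    refine ext_of_forall_integral_eq_of_IsFiniteMeasure fun g => ?_
    rw [integral_map (measurable_const_add s).aemeasurable g.continuous.aestronglyMeasurable]
    -- `I` is continuous and constant on the dense orbit of multiples of `r`, hence constant; so `m`
    -- is invariant under all translations and is a Haar measure.
    set I : UnitAddCircle → ℝ := fun s => ∫ x, g (s + x) ∂m with hI
    have hIc : Continuous I := by
      refine continuous_of_dominated (bound := fun _ => ‖g‖)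
        (fun s => (g.continuous.comp (continuous_const_add s)).aestronglyMeasurable)
        (fun s => Eventually.of_forall fun x => g.norm_coe_le_norm _) (integrable_const _)
        (Eventually.of_forall fun x => g.continuous.comp (continuous_add_const x))
    have hIr (s : UnitAddCircle) : I (r + s) = I s := by
      have h1 : I s = ∫ x, g (s + x) ∂(m.map (fun x => (r : UnitAddCircle) + x)) := by rw [h]
      have h2 := integral_map (μ := m) (measurable_const_add (r : UnitAddCircle)).aemeasurable
        (f := fun x => g (s + x))
        (g.continuous.comp (continuous_const_add s)).aestronglyMeasurable
      refine Eq.trans ?_ (h1.trans h2).symm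
      simp only [hI]
      congr 1 with x
      rw [add_comm (r : UnitAddCircle) s, add_assoc]
    have hIz (n : ℤ) : I (n • (r : UnitAddCircle)) = I 0 := by
      induction n using Int.induction_on with
      | zero => simp
      | succ n ih => rw [add_smul, one_smul, add_comm, hIr, ih]
      | pred n ih => rw [← hIr, ← ih, sub_smul, one_smul, add_sub_cancel]
    have hconst : I = fun _ => I 0 :=
      hdense.equalizer hIc continuous_const (funext hIz)
    have := congrFun hconst s
    simpa [hI] using this
  have h1 := Measure.isAddInvariant_eq_smul_of_compactSpace m (volume : Measure UnitAddCircle)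
  have h2 := congrArg (fun ν : Measure UnitAddCircle => ν Set.univ) h1
  simp only [measure_univ, Measure.smul_apply, UnitAddCircle.measure_univ] at h2
  rw [h1]
  have h3 : m.addHaarScalarFactor volume = 1 := by
    have : ((m.addHaarScalarFactor volume : NNReal) : ENNReal) = 1 := by
      simpa [ENNReal.smul_def] using h2.symm
    exact_mod_cast this
  rw [h3, one_smul]

/-- A monotone degree one map that commutes with an irrational translation is a translation. -/
lemma eq_add_of_commute_irrational (P : CircleDeg1Lift) {r : ℝ} (hr : Irrational r)
    (h : ∀ y, P (r + y) = r + P y) (y : ℝ) : P y = P 0 + y := by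
  -- `P` commutes with translation by `r` and by `1`, hence by the dense group they generate;
  -- monotonicity extends the formula from this group to all reals.
  set S : Set ℝ := ((AddSubgroup.closure {r, 1} : AddSubgroup ℝ) : Set ℝ)
  have hd : Dense S := dense_addSubgroupClosure_pair_iff.2 (by simpa using hr)
  have hP : ∀ s ∈ S, ∀ x, P (x + s) = P x + s := by
    intro s hs
    refine AddSubgroup.closure_induction (p := fun s _ => ∀ x, P (x + s) = P x + s)
      ?_ ?_ ?_ ?_ hs
    · rintro s (rfl | rfl) x
      · rw [add_comm x, h, add_comm]
      · exact P.map_add_one x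
    · simp
    · intro a b _ _ ha hb x
      rw [← add_assoc, hb, ha, add_assoc]
    · intro a _ ha x
      have := ha (x + -a)
      rw [neg_add_cancel_right] at this
      linarith
  have hP0 : ∀ s ∈ S, P s = P 0 + s := fun s hs => by simpa using hP s hs 0
  apply le_antisymm
  · refine le_of_forall_gt fun c hc => ?_
    obtain ⟨s, hs, h1, h2⟩ := hd.exists_between (show y < c - P 0 by linarith)
    have := P.monotone h1.le
    rw [hP0 s hs] at this
    linarith
  · refine le_of_forall_lt fun c hc => ?_
    obtain ⟨s, hs, h1, h2⟩ := hd.exists_between (show c - P 0 < y by linarith)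
    have := P.monotone h2.le
    rw [hP0 s hs] at this
    linarith

/-- An orientation preserving circle homeomorphism with irrational rotation number is uniquely
ergodic. -/
theorem existsUnique_isInvariantProbability (Φ : CircleDeg1Lift) (hΦ : Function.Bijective Φ)
    (hirr : Irrational Φ.translationNumber) :
    ∃! μ : Measure UnitAddCircle, IsInvariantProbability Φ μ := by
  set r := Φ.translationNumber
  set R : CircleDeg1Lift :=
    ((CircleDeg1Lift.translate (Multiplicative.ofAdd r) : CircleDeg1Liftˣ) : CircleDeg1Lift)
  have hRb : Function.Bijective R := CircleDeg1Lift.isUnit_iff_bijective.1 (Units.isUnit _)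
  have hRτ : R.translationNumber = r := CircleDeg1Lift.translationNumber_translate r
  obtain ⟨F, hF⟩ :=
    CircleDeg1Lift.semiconj_of_bijective_of_translationNumber_eq hΦ hRb hRτ.symm
  obtain ⟨G, hG⟩ :=
    CircleDeg1Lift.semiconj_of_bijective_of_translationNumber_eq hRb hΦ hRτ
  have hF' : ∀ x, F (Φ x) = r + F x := hF
  have hG' : ∀ y, G (r + y) = Φ (G y) := hG
  have hGm := measurable_phaseMap G
  have hFm := measurable_phaseMap F
  have hΦm := measurable_phaseMap Φ
  have hrm : Measurable fun x : UnitAddCircle => (r : UnitAddCircle) + x :=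
    measurable_const_add _
  have hvol : IsProbabilityMeasure (volume : Measure UnitAddCircle) :=
    ⟨UnitAddCircle.measure_univ⟩
  refine existsUnique_of_exists_of_unique ?_ ?_
  · refine ⟨(volume : Measure UnitAddCircle).map (phaseMap G),
      Measure.isProbabilityMeasure_map hGm.aemeasurable, hΦm, ?_⟩
    have hcomp : phaseMap Φ ∘ phaseMap G =
        phaseMap G ∘ fun x : UnitAddCircle => (r : UnitAddCircle) + x := by
      funext x
      induction x using QuotientAddGroup.induction_on with
      | H y =>
        change phaseMap Φ (phaseMap G (y : UnitAddCircle)) =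
          phaseMap G ((r : UnitAddCircle) + (y : UnitAddCircle))
        rw [← AddCircle.coe_add, phaseMap_coe, phaseMap_coe, phaseMap_coe, hG']
    rw [Measure.map_map hΦm hGm, hcomp, ← Measure.map_map hGm hrm,
      (measurePreserving_add_left volume (r : UnitAddCircle)).map_eq]
  · set P : CircleDeg1Lift := F * G with hPdef
    have hP : ∀ y, F (G y) = P 0 + y := eq_add_of_commute_irrational P hirr fun y => by
      simp only [hPdef, CircleDeg1Lift.mul_apply, hG', hF']
    -- The values on which the monotone map `F` is not injective; there are only countably many.
    set D : Set ℝ := {c | ∃ x y, x < y ∧ F x = c ∧ F y = c} with hD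
    have hDc : D.Countable := F.monotone.countable_setOfPred_two_preimages
    -- Both points have the same image under `F`, because `F ∘ G` is translation by `P 0`.
    have hGF (t : ℝ) (ht : F t ∉ D) : G (F t - P 0) = t := by
      by_contra hne
      have he : F (G (F t - P 0)) = F t := by rw [hP]; ring
      rcases lt_or_gt_of_ne hne with hlt | hlt
      · exact ht ⟨_, _, hlt, he, rfl⟩
      · exact ht ⟨_, _, hlt, rfl, he⟩
    -- An almost everywhere left inverse of the circle map of `F`. It does not depend on `ν`, so `ν`
    -- is recovered as a fixed image of Lebesgue measure.
    set γ : UnitAddCircle → UnitAddCircle := fun x => phaseMap G (x - (P 0 : ℝ)) with hγ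
    have hγm : Measurable γ := hGm.comp (measurable_sub_const _)
    have key (ν : Measure UnitAddCircle) (hν : IsInvariantProbability Φ ν) :
        ν = (volume : Measure UnitAddCircle).map γ := by
      obtain ⟨hprob, hinv⟩ := hν
      have hcomp : phaseMap F ∘ phaseMap Φ =
          (fun x : UnitAddCircle => (r : UnitAddCircle) + x) ∘ phaseMap F := by
        funext x
        induction x using QuotientAddGroup.induction_on with
        | H y =>
          change phaseMap F (phaseMap Φ (y : UnitAddCircle)) =
            (r : UnitAddCircle) + phaseMap F (y : UnitAddCircle)
          rw [phaseMap_coe, phaseMap_coe, phaseMap_coe, hF', AddCircle.coe_add]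
      have : IsProbabilityMeasure (ν.map (phaseMap F)) :=
        Measure.isProbabilityMeasure_map hFm.aemeasurable
      have hvol : ν.map (phaseMap F) = volume := by
        refine eq_volume_of_map_irrational_rotation _ hirr ?_
        rw [Measure.map_map hrm hFm, ← hcomp, ← Measure.map_map hFm hΦm, hinv.map_eq]
      have hDcirc : (((↑) : ℝ → UnitAddCircle) '' D).Countable := hDc.image _
      have hnull : ν (phaseMap F ⁻¹' (((↑) : ℝ → UnitAddCircle) '' D)) = 0 := by
        rw [← Measure.map_apply hFm hDcirc.measurableSet, hvol]
        rw [← Set.biUnion_of_singleton (((↑) : ℝ → UnitAddCircle) '' D)]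
        exact (measure_biUnion_null_iff hDcirc).2 fun x _ => volume_singleton_circle x
      have hae : γ ∘ phaseMap F =ᵐ[ν] id := by
        refine measure_mono_null (fun x hx => ?_) hnull
        induction x using QuotientAddGroup.induction_on with
        | H t =>
          by_contra hcon
          refine hx ?_
          have ht : F t ∉ D := fun hmem => hcon ⟨F t, hmem, (phaseMap_coe F t).symm⟩
          change phaseMap G (phaseMap F (t : UnitAddCircle) - (P 0 : ℝ)) = (t : UnitAddCircle)
          rw [phaseMap_coe, ← AddCircle.coe_sub, phaseMap_coe, hGF t ht]
      rw [← hvol, Measure.map_map hγm hFm, Measure.map_congr hae, Measure.map_id]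
    intro ν₁ ν₂ h₁ h₂
    rw [key ν₁ h₁, key ν₂ h₂]

end Circle

/-! ### Interspike-interval statistics of a circle lift. -/

section Statistics

lemma birkhoffAverage_displacement_coe (Φ : CircleDeg1Lift) (n : ℕ) (t : ℝ) :
    birkhoffAverage ℝ (phaseMap Φ) (displacement Φ) n (t : UnitAddCircle) =
      ((Φ ^ n) t - t) / n := by
  simp only [birkhoffAverage, birkhoffSum, displacement_iterate_phaseMap_coe, ISI,
    Finset.sum_range_sub (fun i => Φ^[i] t), smul_eq_mul, CircleDeg1Lift.coe_pow,
    Function.iterate_zero, id_eq]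
  rw [div_eq_inv_mul]

lemma integral_birkhoffAverage {X : Type*} [MeasurableSpace X] {μ : Measure X} {T : X → X}
    (hT : MeasurePreserving T μ μ) {g : X → ℝ} (hg : Integrable g μ) {n : ℕ} (hn : n ≠ 0) :
    ∫ x, birkhoffAverage ℝ T g n x ∂μ = ∫ x, g x ∂μ := by
  have h (i : ℕ) : ∫ x, g (T^[i] x) ∂μ = ∫ x, g x ∂μ := by
    have hi := hT.iterate i
    have := integral_map (μ := μ) hi.aemeasurable (f := g) (by rw [hi.map_eq]; exact hg.1)
    rw [← this, hi.map_eq]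
  simp only [birkhoffAverage, birkhoffSum, smul_eq_mul]
  rw [integral_const_mul, integral_finsetSum]
  · simp only [h, Finset.sum_const, Finset.card_range, nsmul_eq_mul]
    field_simp
  · exact fun i _ => (hT.iterate i).integrable_comp_of_integrable hg

lemma integrable_displacement {Φ : CircleDeg1Lift} (hΦ : Continuous Φ)
    (μ : Measure UnitAddCircle) [IsFiniteMeasure μ] : Integrable (displacement Φ) μ :=
  (continuous_displacement hΦ).integrable_of_hasCompactSupport (.of_compactSpace _)

/-- By invariance every Birkhoff average of `Ψ` of positive length has the integral of `Ψ`. The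
averages are bounded by `sup |Ψ|` and, by telescoping, converge everywhere to the translation
number, so dominated convergence applies. -/
theorem integral_displacement {Φ : CircleDeg1Lift} (hΦ : Continuous Φ)
    {μ : Measure UnitAddCircle} (hμ : IsInvariantProbability Φ μ) :
    ∫ θ, displacement Φ θ ∂μ = Φ.translationNumber := by
  obtain ⟨hprob, hinv⟩ := hμ
  have hcont := continuous_displacement hΦ
  obtain ⟨C, hC⟩ := isCompact_univ.exists_bound_of_continuousOn hcont.continuousOn
  have hlim : Tendsto (fun n : ℕ => ∫ θ, birkhoffAverage ℝ (phaseMap Φ) (displacement Φ) n θ ∂μ)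
      atTop (𝓝 (∫ _, Φ.translationNumber ∂μ)) := by
    refine tendsto_integral_of_dominated_convergence (fun _ => C) (fun n => ?_)
      (integrable_const _) (fun n => Eventually.of_forall fun θ => ?_)
      (Eventually.of_forall fun θ => ?_)
    · refine Continuous.aestronglyMeasurable ?_
      exact (continuous_finsetSum _ fun i _ =>
        hcont.comp ((continuous_phaseMap hΦ).iterate i)).const_smul (n : ℝ)⁻¹
    · have hC0 : 0 ≤ C := (norm_nonneg _).trans (hC 0 (Set.mem_univ _))
      simp only [birkhoffAverage, birkhoffSum, norm_smul, norm_inv, Real.norm_natCast]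
      have hs : ‖∑ i ∈ Finset.range n, displacement Φ ((phaseMap Φ)^[i] θ)‖ ≤ n * C := by
        simpa using norm_sum_le_of_le (Finset.range n)
          (f := fun i => displacement Φ ((phaseMap Φ)^[i] θ)) (fun i _ => hC _ (Set.mem_univ _))
      rcases Nat.eq_zero_or_pos n with rfl | hn
      · simpa using hC0
      · have hn' : (0 : ℝ) < n := Nat.cast_pos.2 hn
        rw [inv_mul_le_iff₀ hn']
        exact hs
    · rw [← coe_rep θ]
      simp only [birkhoffAverage_displacement_coe]
      exact Φ.tendsto_translationNumber _
  rw [integral_const, probReal_univ, one_smul] at hlim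
  refine tendsto_nhds_unique (tendsto_const_nhds.congr' ?_) hlim
  filter_upwards [eventually_ne_atTop 0] with n hn
  exact (integral_birkhoffAverage hinv (integrable_displacement hΦ μ) hn).symm

lemma tendsto_iterate_div (Φ : CircleDeg1Lift) (t : ℝ) :
    Tendsto (fun n : ℕ => Φ^[n] t / n) atTop (𝓝 Φ.translationNumber) := by
  have h1 := Φ.tendsto_translationNumber t
  have h2 : Tendsto (fun n : ℕ => t / n) atTop (𝓝 0) :=
    tendsto_const_nhds.div_atTop tendsto_natCast_atTop_atTop
  have h3 := h1.add h2
  rw [add_zero] at h3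
  refine h3.congr fun n => ?_
  rw [CircleDeg1Lift.coe_pow, ← add_div, sub_add_cancel]

lemma rotationNumber_eq_translationNumber (Φ : CircleDeg1Lift) :
    rotationNumber Φ = Φ.translationNumber :=
  (tendsto_iterate_div Φ 0).limUnder_eq

lemma isiDistribution_real {Φ : CircleDeg1Lift} (hΦ : Continuous Φ) (μ : Measure UnitAddCircle)
    {A : Set ℝ} (hA : MeasurableSet A) :
    (isiDistribution Φ μ).real A = μ.real (displacement Φ ⁻¹' A) := by
  rw [measureReal_def, isiDistribution, Measure.map_apply (continuous_displacement hΦ).measurable hA,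
    measureReal_def]

theorem tendstoUniformly_isiFrequency {Φ : CircleDeg1Lift} (hΦ : Continuous Φ)
    (hbij : Function.Bijective Φ) (hirr : Irrational Φ.translationNumber)
    {μ : Measure UnitAddCircle} (hμ : IsInvariantProbability Φ μ) {A : Set ℝ}
    (hA : MeasurableSet A) (hfr : μ (frontier (displacement Φ ⁻¹' A)) = 0) :
    TendstoUniformly (fun (n : ℕ) (t : ℝ) => isiFrequency Φ A n t)
      (fun _ => (isiDistribution Φ μ).real A) atTop := by
  have hprob := hμ.1
  have huniq (ν : Measure UnitAddCircle) (h1 : IsProbabilityMeasure ν)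
      (h2 : MeasurePreserving (phaseMap Φ) ν ν) : ν = μ :=
    (existsUnique_isInvariantProbability Φ hbij hirr).unique ⟨h1, h2⟩ hμ
  have h := (tendstoUniformly_birkhoffAverage_indicator (continuous_phaseMap hΦ) μ huniq
    ((continuous_displacement hΦ).measurable hA) hfr).comp ((↑) : ℝ → UnitAddCircle)
  simp only [isiFrequency_eq_birkhoffAverage, isiDistribution_real hΦ μ hA]
  exact h

theorem ae_tendsto_isiFrequency {Φ : CircleDeg1Lift} (hΦ : Continuous Φ)
    (hbij : Function.Bijective Φ) (hirr : Irrational Φ.translationNumber)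
    {μ : Measure UnitAddCircle} (hμ : IsInvariantProbability Φ μ) {A : Set ℝ}
    (hA : MeasurableSet A) :
    ∀ᵐ (θ : UnitAddCircle) ∂μ, ∀ t : ℝ, (t : UnitAddCircle) = θ →
      Tendsto (fun n : ℕ => isiFrequency Φ A n t) atTop (𝓝 ((isiDistribution Φ μ).real A)) := by
  have hprob := hμ.1
  have huniq (ν : Measure UnitAddCircle) (h1 : IsProbabilityMeasure ν)
      (h2 : MeasurePreserving (phaseMap Φ) ν ν) : ν = μ :=
    (existsUnique_isInvariantProbability Φ hbij hirr).unique ⟨h1, h2⟩ hμ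
  filter_upwards [ae_tendsto_birkhoffAverage_indicator (continuous_phaseMap hΦ) μ huniq hμ.2
    ((continuous_displacement hΦ).measurable hA)] with θ hθ t ht
  subst ht
  simp only [isiFrequency_eq_birkhoffAverage, isiDistribution_real hΦ μ hA]
  exact hθ

/-- By continuity of `Ψ`, the boundary of `Ψ⁻¹(A)` lies in `Ψ⁻¹(∂A)`. -/
lemma measure_frontier_preimage_displacement {Φ : CircleDeg1Lift} (hΦ : Continuous Φ)
    {μ : Measure UnitAddCircle} {A : Set ℝ} (h : isiDistribution Φ μ (frontier A) = 0) :
    μ (frontier (displacement Φ ⁻¹' A)) = 0 := by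
  have hc := continuous_displacement hΦ
  rw [isiDistribution, Measure.map_apply hc.measurable isClosed_frontier.measurableSet] at h
  exact measure_mono_null (hc.frontier_preimage_subset A) h

end Statistics

/-! ### The firing map as a lift of a circle homeomorphism. -/

section FiringMap

/-- The integrand in the definition of the firing map. -/
noncomputable def drive (σ : ℝ) (f : ℝ → ℝ) (u : ℝ) : ℝ := (f u - σ) * Real.exp (σ * u)

variable {σ : ℝ} {f : ℝ → ℝ}

lemma intervalIntegrable_drive (hf : LocallyIntegrable f volume) (a b : ℝ) :
    IntervalIntegrable (drive σ f) volume a b := by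
  have h1 : IntervalIntegrable f volume a b :=
    (hf.integrableOn_isCompact isCompact_uIcc).intervalIntegrable
  exact (h1.sub intervalIntegrable_const).mul_continuousOn (by fun_prop)

lemma integral_drive_pos (hf : LocallyIntegrable f volume)
    (hpos : ∀ᵐ t ∂(volume : Measure ℝ), 0 < f t - σ) {a b : ℝ} (hab : a < b) :
    0 < ∫ u in a..b, drive σ f u := by
  have hp : ∀ᵐ u ∂(volume : Measure ℝ), 0 < drive σ f u := by
    filter_upwards [hpos] with u hu
    exact mul_pos hu (Real.exp_pos _)
  rw [intervalIntegral.integral_pos_iff_support_of_nonneg_ae (hp.mono fun _ h => h.le)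
    (intervalIntegrable_drive hf a b)]
  refine ⟨hab, ?_⟩
  have hae : (Function.support (drive σ f) ∩ Set.Ioc a b : Set ℝ) =ᵐ[volume] Set.Ioc a b := by
    filter_upwards [hp] with u hu
    exact propext ⟨fun h => h.2, fun h => ⟨hu.ne', h⟩⟩
  rw [measure_congr hae]
  simpa using hab

lemma integral_drive_add_one (hper : ∀ᵐ t ∂(volume : Measure ℝ), f (t + 1) = f t) (a b : ℝ) :
    ∫ u in (a + 1)..(b + 1), drive σ f u = Real.exp σ * ∫ u in a..b, drive σ f u := by
  rw [← intervalIntegral.integral_comp_add_right, ← intervalIntegral.integral_const_mul]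
  refine intervalIntegral.integral_congr_ae ?_
  filter_upwards [hper] with u hu _
  rw [drive, hu, mul_add, mul_one, Real.exp_add, drive]
  ring

/-- Each further period multiplies the integral by `e^σ ≥ 1`, so it grows at least linearly. Hence
the threshold is reached and the infimum defining `firingMap` is not over the empty set. -/
lemma nat_mul_le_integral_drive (hσ : 0 ≤ σ) (hf : LocallyIntegrable f volume)
    (hper : ∀ᵐ t ∂(volume : Measure ℝ), f (t + 1) = f t)
    (hpos : ∀ᵐ t ∂(volume : Measure ℝ), 0 < f t - σ) (t : ℝ) (n : ℕ) :
    n * ∫ u in t..(t + 1), drive σ f u ≤ ∫ u in t..(t + n), drive σ f u := by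
  have hunit (n : ℕ) :
      ∫ u in t..(t + 1), drive σ f u ≤ ∫ u in (t + n)..(t + n + 1), drive σ f u := by
    induction n with
    | zero => simp
    | succ n ih =>
      have h := integral_drive_add_one (σ := σ) hper (t + n) (t + n + 1)
      have h0 := integral_drive_pos hf hpos (show t + n < t + n + 1 by linarith)
      have h1 : 1 ≤ Real.exp σ := Real.one_le_exp hσ
      push_cast
      rw [← add_assoc, h]
      nlinarith
  induction n with
  | zero => simp
  | succ n ih =>
    have h := intervalIntegral.integral_add_adjacent_intervals
      (intervalIntegrable_drive (σ := σ) hf t (t + n))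
      (intervalIntegrable_drive (σ := σ) hf (t + n) (t + n + 1))
    push_cast
    rw [← add_assoc, ← h, add_mul, one_mul]
    exact add_le_add ih (hunit n)

/-- The primitive of `drive` that vanishes at `0`. -/
noncomputable def cumulativeDrive (σ : ℝ) (f : ℝ → ℝ) (s : ℝ) : ℝ := ∫ u in (0 : ℝ)..s, drive σ f u

lemma integral_drive (hf : LocallyIntegrable f volume) (a b : ℝ) :
    ∫ u in a..b, drive σ f u = cumulativeDrive σ f b - cumulativeDrive σ f a :=
  (intervalIntegral.integral_interval_sub_left (intervalIntegrable_drive hf 0 b)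
    (intervalIntegrable_drive hf 0 a)).symm

lemma continuous_cumulativeDrive (hf : LocallyIntegrable f volume) :
    Continuous (cumulativeDrive σ f) :=
  intervalIntegral.continuous_primitive (intervalIntegrable_drive hf) 0

lemma strictMono_cumulativeDrive (hf : LocallyIntegrable f volume)
    (hpos : ∀ᵐ t ∂(volume : Measure ℝ), 0 < f t - σ) : StrictMono (cumulativeDrive σ f) := by
  intro a b hab
  have := integral_drive_pos hf hpos hab
  rw [integral_drive hf] at this
  linarith

/-- The firing condition determines the firing map as an implicit function. -/
theorem cumulativeDrive_firingMap (hσ : 0 ≤ σ) (hf : LocallyIntegrable f volume)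
    (hper : ∀ᵐ t ∂(volume : Measure ℝ), f (t + 1) = f t)
    (hpos : ∀ᵐ t ∂(volume : Measure ℝ), 0 < f t - σ) (t : ℝ) :
    cumulativeDrive σ f (firingMap σ f t) = cumulativeDrive σ f t + Real.exp (σ * t) := by
  set W := cumulativeDrive σ f with hW
  have hWm : StrictMono W := strictMono_cumulativeDrive hf hpos
  have hWc : Continuous W := continuous_cumulativeDrive hf
  have hunit := integral_drive_pos hf hpos (show t < t + 1 by linarith)
  obtain ⟨n, hn⟩ := exists_nat_ge (Real.exp (σ * t) / ∫ u in t..(t + 1), drive σ f u)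
  rw [div_le_iff₀ hunit] at hn
  have hn' := hn.trans (nat_mul_le_integral_drive hσ hf hper hpos t n)
  rw [integral_drive hf] at hn'
  have hexp := Real.exp_pos (σ * t)
  obtain ⟨s, -, hs⟩ := intermediate_value_Icc (show t ≤ t + n by simp) hWc.continuousOn
    (show W t + Real.exp (σ * t) ∈ Set.Icc (W t) (W (t + n)) from
      ⟨by linarith, by linarith⟩)
  have hts : t < s := hWm.lt_iff_lt.1 (by linarith)
  -- As `W` increases strictly, the admissible times form the closed ray from the crossing time `s`,
  -- so the infimum is attained there.
  have hset : {s' : ℝ | t < s' ∧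
      Real.exp (σ * t) ≤ ∫ u in t..s', (f u - σ) * Real.exp (σ * u)} = Set.Ici s := by
    ext s'
    have e : ∫ u in t..s', (f u - σ) * Real.exp (σ * u) = W s' - W t := integral_drive hf t s'
    simp only [Set.mem_ofPred_eq, Set.mem_Ici, e]
    rw [← hWm.le_iff_le (a := s), hs]
    constructor
    · rintro ⟨-, h⟩
      linarith
    · intro h
      exact ⟨hWm.lt_iff_lt.1 (by linarith), by linarith⟩
  rw [firingMap, hset, csInf_Ici, hs]

/-- The firing map is a lift of an orientation preserving circle homeomorphism. -/
theorem exists_circleDeg1Lift_eq_firingMap (hσ : 0 ≤ σ) (hf : LocallyIntegrable f volume)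
    (hper : ∀ᵐ t ∂(volume : Measure ℝ), f (t + 1) = f t)
    (hpos : ∀ᵐ t ∂(volume : Measure ℝ), 0 < f t - σ) :
    ∃ Φ : CircleDeg1Lift, ⇑Φ = firingMap σ f ∧ Continuous Φ ∧ Function.Bijective Φ := by
  have hWm : StrictMono (cumulativeDrive σ f) := strictMono_cumulativeDrive hf hpos
  have hWc : Continuous (cumulativeDrive σ f) := continuous_cumulativeDrive hf
  have key := cumulativeDrive_firingMap hσ hf hper hpos
  have hmono : StrictMono (firingMap σ f) := by
    intro a b hab
    rw [← hWm.lt_iff_lt, key, key]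
    exact add_lt_add_of_lt_of_le (hWm hab)
      (Real.exp_le_exp.2 (mul_le_mul_of_nonneg_left hab.le hσ))
  have hdeg (t : ℝ) : firingMap σ f (t + 1) = firingMap σ f t + 1 := by
    refine hWm.injective ?_
    -- A shift by one period multiplies both the accumulated drive and the threshold `e^{σt}` by
    -- `e^σ`, so `Φ(t) + 1` solves the firing equation at `t + 1`.
    have h := integral_drive_add_one (σ := σ) hper t (firingMap σ f t)
    rw [integral_drive hf, integral_drive hf, key] at h
    rw [key, mul_add, mul_one, Real.exp_add]
    linarith
  have hcont : Continuous (firingMap σ f) := by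
    -- `W` is strictly increasing with an interval as range, hence an embedding; continuity of `Φ`
    -- reduces to that of `W ∘ Φ`, which is explicit.
    have hemb := hWm.isEmbedding_of_ordConnected
      (isPreconnected_range hWc).ordConnected
    rw [hemb.continuous_iff]
    have : cumulativeDrive σ f ∘ firingMap σ f =
        fun t => cumulativeDrive σ f t + Real.exp (σ * t) := funext key
    rw [this]
    fun_prop
  refine ⟨⟨⟨firingMap σ f, hmono.monotone⟩, hdeg⟩, rfl, hcont, hmono.injective, ?_⟩
  exact hcont.surjective (CircleDeg1Lift.tendsto_atTop ⟨⟨firingMap σ f, hmono.monotone⟩, hdeg⟩)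
    (CircleDeg1Lift.tendsto_atBot ⟨⟨firingMap σ f, hmono.monotone⟩, hdeg⟩)

end FiringMap

end LIF

theorem mainTheorem6 (σ : ℝ) (hσ : 0 ≤ σ) (f : ℝ → ℝ)
    (hf : LocallyIntegrable f volume)
    (hper : ∀ᵐ t ∂(volume : Measure ℝ), f (t + 1) = f t)
    (hpos : ∀ᵐ t ∂(volume : Measure ℝ), 0 < f t - σ)
    (hirr : Irrational (LIF.rotationNumber (LIF.firingMap σ f))) :
    -- the invariant probability measure exists and is unique
    (∃! μ : Measure UnitAddCircle, LIF.IsInvariantProbability (LIF.firingMap σ f) μ) ∧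
    ∀ μ : Measure UnitAddCircle, LIF.IsInvariantProbability (LIF.firingMap σ f) μ →
      -- uniform convergence of the frequencies, for sets of phases with null boundary
      (∀ A : Set ℝ, MeasurableSet A →
        μ (frontier (LIF.displacement (LIF.firingMap σ f) ⁻¹' A)) = 0 →
        TendstoUniformly (fun (n : ℕ) (t : ℝ) => LIF.isiFrequency (LIF.firingMap σ f) A n t)
          (fun _ => (LIF.isiDistribution (LIF.firingMap σ f) μ).real A) atTop) ∧
      -- in particular for every continuity set of the interspike-interval distribution
      (∀ A : Set ℝ, MeasurableSet A →
        LIF.isiDistribution (LIF.firingMap σ f) μ (frontier A) = 0 →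
        TendstoUniformly (fun (n : ℕ) (t : ℝ) => LIF.isiFrequency (LIF.firingMap σ f) A n t)
          (fun _ => (LIF.isiDistribution (LIF.firingMap σ f) μ).real A) atTop) ∧
      -- convergence for every Borel set, for almost all initial phases
      (∀ A : Set ℝ, MeasurableSet A → ∀ᵐ (θ : UnitAddCircle) ∂μ, ∀ t : ℝ, (t : UnitAddCircle) = θ →
        Tendsto (fun n : ℕ => LIF.isiFrequency (LIF.firingMap σ f) A n t) atTop
          (𝓝 ((LIF.isiDistribution (LIF.firingMap σ f) μ).real A))) ∧
      -- the average interspike interval exists for every run and is the rotation number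
      (∀ t : ℝ, Tendsto (fun n : ℕ => (LIF.firingMap σ f)^[n] t / n) atTop
        (𝓝 (LIF.rotationNumber (LIF.firingMap σ f)))) ∧
      -- it is the mean of the distribution of interspike intervals
      Integrable (LIF.displacement (LIF.firingMap σ f)) μ ∧
      ∫ θ, LIF.displacement (LIF.firingMap σ f) θ ∂μ
        = LIF.rotationNumber (LIF.firingMap σ f) ∧
      Integrable (fun s : ℝ => s) (LIF.isiDistribution (LIF.firingMap σ f) μ) ∧
      ∫ s, s ∂(LIF.isiDistribution (LIF.firingMap σ f) μ)
        = LIF.rotationNumber (LIF.firingMap σ f) := by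
  obtain ⟨Φ, hΦ, hcont, hbij⟩ := LIF.exists_circleDeg1Lift_eq_firingMap hσ hf hper hpos
  rw [← hΦ] at hirr ⊢
  rw [LIF.rotationNumber_eq_translationNumber] at hirr ⊢
  refine ⟨LIF.existsUnique_isInvariantProbability Φ hbij hirr, fun μ hμ => ?_⟩
  have hprob := hμ.1
  have hint := LIF.integrable_displacement hcont μ
  have hmean := LIF.integral_displacement hcont hμ
  have hmeas := (LIF.continuous_displacement hcont).measurable
  refine ⟨fun A hA hfr => LIF.tendstoUniformly_isiFrequency hcont hbij hirr hμ hA hfr,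
    fun A hA hfr => LIF.tendstoUniformly_isiFrequency hcont hbij hirr hμ hA
      (LIF.measure_frontier_preimage_displacement hcont hfr),
    fun A hA => LIF.ae_tendsto_isiFrequency hcont hbij hirr hμ hA,
    LIF.tendsto_iterate_div Φ, hint, hmean, ?_, ?_⟩
  · exact (integrable_map_measure aestronglyMeasurable_id hmeas.aemeasurable).2 hint
  · exact (integral_map hmeas.aemeasurable aestronglyMeasurable_id).trans hmean
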